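/- Fix a dimension $N\in\mathbb N\cup\{\infty\}$. An $N$-globular set $G$ is a diagram of sets $G_0\leftleftarrows G_1\leftleftarrows G_2\leftleftarrows\cdots$, with $G_k$ defined for all $k\le N$ and with maps $s,t:G_{k+1}\to G_k$ satisfying $ss=st$ and $ts=tt$; for $N=\infty$ it is called a globular set. Two $k$-cells $x,x'$ are parallel if $k=0$, or $k\ge 1$ and $s(x)=s(x')$, $t(x)=t(x')$. For $x,x'\in G_k$ write $G_{k+1}(x,x')=\{z\in G_{k+1}: s(z)=x,\ t(z)=x'\}$. Let $(-)^*$ be the free strict $N$-category monad on $N$-globular sets, that is, the monad of the free-forgetful adjunction between $N$-globular sets and strict $N$-categories, with unit $\eta$ and multiplication $\mu$, and let $\mathbf 1$ be the terminal $N$-globular set. Each cell $\tau$ of positive dimension of $\mathbf 1^*$ has equal source and target, denoted $\partial\tau$. An $N$-globular collection is a morphism $g:G\to\mathbf 1^*$. The collections form a monoidal category whose unit is $\eta_{\mathbf 1}:\mathbf 1\to\mathbf 1^*$; the tensor product of $g:G\to\mathbf 1^*$ and $h:H\to\mathbf 1^*$ is the pullback $G\circ H$ of $!^*:G^*\to\mathbf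 1^*$ and $h$, with structure map $G\circ H\to G^*\xrightarrow{g^*}\mathbf 1^{**}\xrightarrow{\mu_{\mathbf 1}}\mathbf 1^*$. An $N$-globular operad (a globular operad if $N=\infty$) is a monoid in this monoidal category; it has an underlying collection $g:G\to\mathbf 1^*$. A contraction function on $g$ assigns to each triple $(x,x',\tau)$, where $(x,x')$ is a parallel pair of $k$-cells of $G$ ($k+1\le N$) and $\tau$ is a $(k+1)$-cell of $\mathbf 1^*$ with $g(x)=g(x')=\partial\tau$, a $(k+1)$-cell $\chi$ of $G$ with $s(\chi)=x$, $t(\chi)=x'$ and $g(\chi)=\tau$. A globular operad is contractible if there exists a contraction function on its underlying collection. For $n\in\mathbb N$, an $n$-globular operad is contractible if there exists a contraction function on its underlying collection and any two parallel $n$-cells $\chi,\chi'$ of $G$ with $g(\chi)=g(\chi')$ are equal. A morphism $f:G\to H$ of $N$-globular sets is $k$-full (respectively $k$-faithful), for $0<k\le N$, if for each parallel pair $(x,x')$ of $(k-1)$-cells of $G$ the restriction $G_k(x,x')\to H_k(f(x),f(x'))$ of $f$ is surjective (respectively injective). It is full if it is $k$-full for all $0<k\le N$. By convention, $f$ is $0$-faithful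 if it is injective on $0$-cells. Lemma. (i) A globular operad with underlying collection $g:G\to\mathbf 1^*$ is contractible if and only if $g$ is full. (ii) For every $n\in\mathbb N$, an $n$-globular operad with underlying collection $g:G\to\mathbf 1^*$ is contractible if and only if $g$ is full and $n$-faithful. -/

import Mathlib

open CategoryTheory

universe u

/-! ## Globular sets, in dimension `N ≤ ∞` -/

/-- `k` is one of the dimensions `0, 1, …, N` (all natural numbers when `N = ⊤`). -/
def InDim (N : ℕ∞) (k : ℕ) : Prop := (k : ℕ∞) ≤ N

theorem InDim.mono {N : ℕ∞} {p n : ℕ} (hn : InDim N n) (h : p ≤ n) : InDim N p :=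
  le_trans (Nat.cast_le.mpr h) hn

theorem InDim.pred {N : ℕ∞} {k : ℕ} (h : InDim N (k + 1)) : InDim N k := h.mono (Nat.le_succ k)

theorem InDim.zero {N : ℕ∞} : InDim N 0 := by simp [InDim]

theorem InDim.top (k : ℕ) : InDim ⊤ k := le_top

theorem InDim.self (n : ℕ) : InDim (n : ℕ∞) n := le_rfl

/-- An `N`-globular set: `G_0 ⇇ G_1 ⇇ ⋯`, with one set of `k`-cells for every `k ≤ N`, such that
`ss = st` and `ts = tt`. For `N = ⊤` this is a globular set. -/
structure GlobSet (N : ℕ∞) where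
  cell : (k : ℕ) → InDim N k → Type u
  src : ∀ {k : ℕ} {hk : InDim N (k + 1)}, cell (k + 1) hk → cell k hk.pred
  tgt : ∀ {k : ℕ} {hk : InDim N (k + 1)}, cell (k + 1) hk → cell k hk.pred
  src_src : ∀ {k : ℕ} {hk : InDim N (k + 2)} (x : cell (k + 2) hk), src (src x) = src (tgt x)
  tgt_src : ∀ {k : ℕ} {hk : InDim N (k + 2)} (x : cell (k + 2) hk), tgt (src x) = tgt (tgt x)

namespace GlobSet

variable {N : ℕ∞}

/-- A morphism of `N`-globular sets: functions on `k`-cells preserving sources and targets. -/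
@[ext]
structure Hom (G H : GlobSet.{u} N) where
  map : ∀ {k : ℕ} {hk : InDim N k}, G.cell k hk → H.cell k hk
  map_src : ∀ {k : ℕ} {hk : InDim N (k + 1)} (x : G.cell (k + 1) hk),
    map (G.src x) = H.src (map x)
  map_tgt : ∀ {k : ℕ} {hk : InDim N (k + 1)} (x : G.cell (k + 1) hk),
    map (G.tgt x) = H.tgt (map x)

instance : Category (GlobSet.{u} N) where
  Hom := Hom
  id G := { map := fun x => x, map_src := fun _ => rfl, map_tgt := fun _ => rfl }
  comp f g :=
    { map := fun x => g.map (f.map x)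
      map_src := fun x => by rw [f.map_src, g.map_src]
      map_tgt := fun x => by rw [f.map_tgt, g.map_tgt] }

@[simp] theorem id_map (G : GlobSet.{u} N) {k : ℕ} {hk : InDim N k} (x : G.cell k hk) :
    Hom.map (𝟙 G) x = x := rfl

@[simp] theorem comp_map {G H K : GlobSet.{u} N} (f : G ⟶ H) (g : H ⟶ K) {k : ℕ} {hk : InDim N k}
    (x : G.cell k hk) : Hom.map (f ≫ g) x = Hom.map g (Hom.map f x) := rfl

theorem hom_ext {G H : GlobSet.{u} N} (f g : G ⟶ H)
    (h : ∀ (k : ℕ) (hk : InDim N k) (x : G.cell k hk), Hom.map f x = Hom.map g x) : f = g :=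
  Hom.ext (by funext k hk x; exact h k hk x)

/-- The `p`-dimensional source `s^{n-p}(x)` of an `n`-cell, `p ≤ n`. -/
def srcTo (G : GlobSet.{u} N) {n : ℕ} {hn : InDim N n} (p : ℕ) (h : p ≤ n) (x : G.cell n hn) :
    G.cell p (hn.mono h) :=
  Nat.leRec (motive := fun n h => ∀ hn : InDim N n, G.cell n hn → G.cell p (hn.mono h))
    (fun _ x => x) (fun _ _ f hn x => f hn.pred (G.src x)) h hn x

/-- The `p`-dimensional target `t^{n-p}(x)` of an `n`-cell, `p ≤ n`. -/
def tgtTo (G : GlobSet.{u} N) {n : ℕ} {hn : InDim N n} (p : ℕ) (h : p ≤ n) (x : G.cell n hn) :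
    G.cell p (hn.mono h) :=
  Nat.leRec (motive := fun n h => ∀ hn : InDim N n, G.cell n hn → G.cell p (hn.mono h))
    (fun _ x => x) (fun _ _ f hn x => f hn.pred (G.tgt x)) h hn x

theorem srcTo_self (G : GlobSet.{u} N) {n : ℕ} {hn : InDim N n} (x : G.cell n hn) :
    G.srcTo n le_rfl x = x := by
  simp [srcTo, Nat.leRec_self]

theorem tgtTo_self (G : GlobSet.{u} N) {n : ℕ} {hn : InDim N n} (x : G.cell n hn) :
    G.tgtTo n le_rfl x = x := by
  simp [tgtTo, Nat.leRec_self]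

theorem srcTo_succ (G : GlobSet.{u} N) {n p : ℕ} {hn : InDim N (n + 1)} (h : p ≤ n)
    (x : G.cell (n + 1) hn) : G.srcTo p (Nat.le_succ_of_le h) x = G.srcTo p h (G.src x) := by
  unfold srcTo
  rw [Nat.leRec_succ _ _ h]

theorem tgtTo_succ (G : GlobSet.{u} N) {n p : ℕ} {hn : InDim N (n + 1)} (h : p ≤ n)
    (x : G.cell (n + 1) hn) : G.tgtTo p (Nat.le_succ_of_le h) x = G.tgtTo p h (G.tgt x) := by
  unfold tgtTo
  rw [Nat.leRec_succ _ _ h]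

theorem srcTo_src (G : GlobSet.{u} N) {n p : ℕ} {hn : InDim N (n + 1)} (h : p < n)
    (x : G.cell (n + 1) hn) : G.srcTo p h.le (G.src x) = G.srcTo p h.le (G.tgt x) := by
  cases n with
  | zero => omega
  | succ n =>
    rw [G.srcTo_succ (Nat.le_of_lt_succ h), G.srcTo_succ (Nat.le_of_lt_succ h), G.src_src]

theorem tgtTo_src (G : GlobSet.{u} N) {n p : ℕ} {hn : InDim N (n + 1)} (h : p < n)
    (x : G.cell (n + 1) hn) : G.tgtTo p h.le (G.src x) = G.tgtTo p h.le (G.tgt x) := by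
  cases n with
  | zero => omega
  | succ n =>
    rw [G.tgtTo_succ (Nat.le_of_lt_succ h), G.tgtTo_succ (Nat.le_of_lt_succ h), G.tgt_src]

theorem Hom.map_srcTo {G H : GlobSet.{u} N} (f : Hom G H) {n : ℕ} {hn : InDim N n} (p : ℕ)
    (h : p ≤ n) (x : G.cell n hn) : f.map (G.srcTo p h x) = H.srcTo p h (f.map x) := by
  induction n, h using Nat.le_induction with
  | base => rw [srcTo_self, srcTo_self]
  | succ n h ih => rw [G.srcTo_succ h, H.srcTo_succ h, ih, f.map_src]

theorem Hom.map_tgtTo {G H : GlobSet.{u} N} (f : Hom G H) {n : ℕ} {hn : InDim N n} (p : ℕ)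
    (h : p ≤ n) (x : G.cell n hn) : f.map (G.tgtTo p h x) = H.tgtTo p h (f.map x) := by
  induction n, h using Nat.le_induction with
  | base => rw [tgtTo_self, tgtTo_self]
  | succ n h ih => rw [G.tgtTo_succ h, H.tgtTo_succ h, ih, f.map_tgt]

/-- Cells are parallel if they have the same source and the same target; any two `0`-cells are
parallel. -/
def Parallel (G : GlobSet.{u} N) : ∀ {k : ℕ} {hk : InDim N k}, G.cell k hk → G.cell k hk → Prop
  | 0, _, _, _ => True
  | _ + 1, _, x, x' => G.src x = G.src x' ∧ G.tgt x = G.tgt x'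

/-- The set `G_{k+1}(x, x')` of `(k+1)`-cells `x ⟶ x'`. -/
def HomCell (G : GlobSet.{u} N) {k : ℕ} (hk : InDim N (k + 1)) (x x' : G.cell k hk.pred) : Type u :=
  { z : G.cell (k + 1) hk // G.src z = x ∧ G.tgt z = x' }

/-- The restriction `G_{k+1}(x, x') → H_{k+1}(f x, f x')` of a morphism of globular sets. -/
def restrict {G H : GlobSet.{u} N} (f : G ⟶ H) {k : ℕ} (hk : InDim N (k + 1))
    (x x' : G.cell k hk.pred) : G.HomCell hk x x' → H.HomCell hk (Hom.map f x) (Hom.map f x') :=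
  fun z => ⟨Hom.map f z.1, by rw [← Hom.map_src, z.2.1], by rw [← Hom.map_tgt, z.2.2]⟩

/-- `f` is `k`-full. In dimension `0` (where there is one pair of `(-1)`-cells, by convention)
this is surjectivity on `0`-cells. -/
def KFull {G H : GlobSet.{u} N} (f : G ⟶ H) : (k : ℕ) → InDim N k → Prop
  | 0, hk => Function.Surjective (fun x : G.cell 0 hk => Hom.map f x)
  | _ + 1, hk => ∀ x x', G.Parallel x x' → Function.Surjective (restrict f hk x x')

/-- `f` is `k`-faithful. In dimension `0` (where there is one pair of `(-1)`-cells, by convention)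
this is injectivity on `0`-cells. -/
def KFaithful {G H : GlobSet.{u} N} (f : G ⟶ H) : (k : ℕ) → InDim N k → Prop
  | 0, hk => Function.Injective (fun x : G.cell 0 hk => Hom.map f x)
  | _ + 1, hk => ∀ x x', G.Parallel x x' → Function.Injective (restrict f hk x x')

/-- `f` is full: it is `k`-full for all `k > 0`. -/
def IsFull {G H : GlobSet.{u} N} (f : G ⟶ H) : Prop :=
  ∀ (k : ℕ) (hk : InDim N k), 0 < k → KFull f k hk

/-- The terminal globular set `1`. -/
def one (N : ℕ∞) : GlobSet.{u} N where
  cell _ _ := PUnit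
  src _ := PUnit.unit
  tgt _ := PUnit.unit
  src_src _ := rfl
  tgt_src _ := rfl

/-- The unique morphism `G ⟶ 1`. -/
def toOne (G : GlobSet.{u} N) : G ⟶ one N where
  map _ := PUnit.unit
  map_src _ := rfl
  map_tgt _ := rfl

theorem toOne_unique {G : GlobSet.{u} N} (f g : G ⟶ one N) : f = g :=
  hom_ext _ _ fun _ _ _ => rfl

/-- The pullback of globular sets, formed dimensionwise. -/
def pull {A B C : GlobSet.{u} N} (f : A ⟶ C) (g : B ⟶ C) : GlobSet.{u} N where
  cell k hk := { z : A.cell k hk × B.cell k hk // Hom.map f z.1 = Hom.map g z.2 }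
  src z := ⟨(A.src z.1.1, B.src z.1.2), by
    change Hom.map f (A.src _) = Hom.map g (B.src _)
    rw [Hom.map_src, Hom.map_src, z.2]⟩
  tgt z := ⟨(A.tgt z.1.1, B.tgt z.1.2), by
    change Hom.map f (A.tgt _) = Hom.map g (B.tgt _)
    rw [Hom.map_tgt, Hom.map_tgt, z.2]⟩
  src_src z := Subtype.ext (Prod.ext (A.src_src z.1.1) (B.src_src z.1.2))
  tgt_src z := Subtype.ext (Prod.ext (A.tgt_src z.1.1) (B.tgt_src z.1.2))

section
variable {A B C : GlobSet.{u} N} (f : A ⟶ C) (g : B ⟶ C)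

def pullFst : pull f g ⟶ A where
  map z := z.1.1
  map_src _ := rfl
  map_tgt _ := rfl

def pullSnd : pull f g ⟶ B where
  map z := z.1.2
  map_src _ := rfl
  map_tgt _ := rfl

theorem pull_condition : pullFst f g ≫ f = pullSnd f g ≫ g :=
  hom_ext _ _ fun _ _ z => z.2

variable {f g}

def pullLift {X : GlobSet.{u} N} (a : X ⟶ A) (b : X ⟶ B) (h : a ≫ f = b ≫ g) : X ⟶ pull f g where
  map x := ⟨(Hom.map a x, Hom.map b x), by
    have := congrArg (fun k : X ⟶ C => Hom.map k x) h
    exact this⟩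
  map_src x := Subtype.ext (Prod.ext (Hom.map_src a x) (Hom.map_src b x))
  map_tgt x := Subtype.ext (Prod.ext (Hom.map_tgt a x) (Hom.map_tgt b x))

@[simp] theorem pullLift_fst {X : GlobSet.{u} N} (a : X ⟶ A) (b : X ⟶ B) (h : a ≫ f = b ≫ g) :
    pullLift a b h ≫ pullFst f g = a := rfl

@[simp] theorem pullLift_snd {X : GlobSet.{u} N} (a : X ⟶ A) (b : X ⟶ B) (h : a ≫ f = b ≫ g) :
    pullLift a b h ≫ pullSnd f g = b := rfl

end

end GlobSet

/-! ## Strict `N`-categories -/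

/-- The data of identities and compositions on an `N`-globular set. `comp p y x` is the composite
`y ∘_p x` of two `n`-cells along their common `p`-cell, `p < n`. -/
structure PreCat (N : ℕ∞) extends GlobSet.{u} N where
  idc : ∀ {n : ℕ} {hn : InDim N n} (hn' : InDim N (n + 1)), cell n hn → cell (n + 1) hn'
  comp : ∀ {n : ℕ} {hn : InDim N n} (p : ℕ) (hp : p < n) (y x : cell n hn),
    toGlobSet.srcTo p hp.le y = toGlobSet.tgtTo p hp.le x → cell n hn

/-- The iterated identity on a `p`-cell, an `n`-cell for `p ≤ n`. -/
def PreCat.idTo {N : ℕ∞} (C : PreCat.{u} N) {p : ℕ} {hp : InDim N p} (n : ℕ) (hn : InDim N n)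
    (h : p ≤ n) (x : C.cell p hp) : C.cell n hn :=
  Nat.leRec (motive := fun n _ => ∀ hn : InDim N n, C.cell n hn)
    (fun _ => x) (fun _ _ f hn => C.idc hn (f hn.pred)) h hn

theorem PreCat.idTo_self {N : ℕ∞} (C : PreCat.{u} N) {p : ℕ} {hp : InDim N p} (x : C.cell p hp) :
    C.idTo p hp le_rfl x = x := by
  simp [PreCat.idTo, Nat.leRec_self]

theorem PreCat.idTo_succ {N : ℕ∞} (C : PreCat.{u} N) {p : ℕ} {hp : InDim N p} {n : ℕ}
    (hn : InDim N (n + 1)) (h : p ≤ n) (x : C.cell p hp) :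
    C.idTo (n + 1) hn (Nat.le_succ_of_le h) x = C.idc hn (C.idTo n hn.pred h x) := by
  unfold PreCat.idTo
  rw [Nat.leRec_succ _ _ h]

/-- A strict `N`-category (a strict `ω`-category for `N = ⊤`). In each law, the composability
conditions of the composites that occur are quantified over; those of the iterated composites
are consequences of the others. -/
structure StrCat (N : ℕ∞) extends PreCat.{u} N where
  src_idc : ∀ {n : ℕ} {hn : InDim N (n + 1)} (x : cell n hn.pred), src (idc hn x) = x
  tgt_idc : ∀ {n : ℕ} {hn : InDim N (n + 1)} (x : cell n hn.pred), tgt (idc hn x) = x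
  src_comp_top : ∀ {p : ℕ} {hn : InDim N (p + 1)} (y x : cell (p + 1) hn) (h),
    src (comp p (Nat.lt_succ_self p) y x h) = src x
  tgt_comp_top : ∀ {p : ℕ} {hn : InDim N (p + 1)} (y x : cell (p + 1) hn) (h),
    tgt (comp p (Nat.lt_succ_self p) y x h) = tgt y
  src_comp : ∀ {n p : ℕ} (hp : p < n) {hn : InDim N (n + 1)} (y x : cell (n + 1) hn) (h) (h'),
    src (comp p (Nat.lt_succ_of_lt hp) y x h) = comp p hp (src y) (src x) h'
  tgt_comp : ∀ {n p : ℕ} (hp : p < n) {hn : InDim N (n + 1)} (y x : cell (n + 1) hn) (h) (h'),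
    tgt (comp p (Nat.lt_succ_of_lt hp) y x h) = comp p hp (tgt y) (tgt x) h'
  comp_assoc : ∀ {n p : ℕ} (hp : p < n) {hn : InDim N n} (z y x : cell n hn) (h₁) (h₂) (h₃) (h₄),
    comp p hp (comp p hp z y h₁) x h₂ = comp p hp z (comp p hp y x h₃) h₄
  id_comp : ∀ {n p : ℕ} (hp : p < n) {hn : InDim N n} (x : cell n hn) (h),
    comp p hp (toPreCat.idTo n hn hp.le (toGlobSet.tgtTo p hp.le x)) x h = x
  comp_id : ∀ {n p : ℕ} (hp : p < n) {hn : InDim N n} (x : cell n hn) (h),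
    comp p hp x (toPreCat.idTo n hn hp.le (toGlobSet.srcTo p hp.le x)) h = x
  interchange : ∀ {n p q : ℕ} (hq : q < p) (hp : p < n) {hn : InDim N n} (y' y x' x : cell n hn)
    (h₁) (h₂) (h₃) (h₄) (h₅) (h₆),
    comp q (hq.trans hp) (comp p hp y' y h₁) (comp p hp x' x h₂) h₃ =
      comp p hp (comp q (hq.trans hp) y' x' h₄) (comp q (hq.trans hp) y x h₅) h₆
  idc_comp : ∀ {n q : ℕ} (hq : q < n) {hn : InDim N (n + 1)} (y x : cell n hn.pred) (h) (h'),
    idc hn (comp q hq y x h) = comp q (Nat.lt_succ_of_lt hq) (idc hn y) (idc hn x) h'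

namespace StrCat

variable {N : ℕ∞}

/-- A strict `N`-functor: a morphism of globular sets preserving identities and composition. -/
@[ext]
structure Hom (C D : StrCat.{u} N) where
  hom : C.toGlobSet ⟶ D.toGlobSet
  map_idc : ∀ {n : ℕ} {hn : InDim N (n + 1)} (x : C.cell n hn.pred),
    GlobSet.Hom.map hom (C.idc hn x) = D.idc hn (GlobSet.Hom.map hom x)
  map_comp : ∀ {n p : ℕ} (hp : p < n) {hn : InDim N n} (y x : C.cell n hn) (h) (h'),
    GlobSet.Hom.map hom (C.comp p hp y x h) =
      D.comp p hp (GlobSet.Hom.map hom y) (GlobSet.Hom.map hom x) h'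

/-- The category `Str N-Cat`. -/
instance : Category (StrCat.{u} N) where
  Hom := Hom
  id C := { hom := 𝟙 _, map_idc := fun _ => rfl, map_comp := fun _ _ _ _ _ _ => rfl }
  comp {C D E} f g :=
    { hom := f.hom ≫ g.hom
      map_idc := fun x => by simp [f.map_idc, g.map_idc]
      map_comp := fun {n p} hp {hn} y x h h' => by
        have h₁ : D.srcTo p hp.le (GlobSet.Hom.map f.hom y) =
            D.tgtTo p hp.le (GlobSet.Hom.map f.hom x) := by
          rw [← GlobSet.Hom.map_srcTo, ← GlobSet.Hom.map_tgtTo, h]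
        rw [GlobSet.comp_map, f.map_comp hp y x h h₁, g.map_comp hp _ _ h₁ h']
        rfl }

/-- The forgetful functor `U : Str N-Cat ⥤ GSet_N`. -/
def forget (N : ℕ∞) : StrCat.{u} N ⥤ GlobSet.{u} N where
  obj C := C.toGlobSet
  map f := Hom.hom f

theorem src_composable (C : StrCat.{u} N) {n p : ℕ} (hp : p < n) {hn : InDim N (n + 1)}
    {y x : C.cell (n + 1) hn}
    (h : C.srcTo p (Nat.lt_succ_of_lt hp).le y = C.tgtTo p (Nat.lt_succ_of_lt hp).le x) :
    C.srcTo p hp.le (C.src y) = C.tgtTo p hp.le (C.src x) := by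
  rw [← C.srcTo_succ hp.le, C.tgtTo_src hp, ← C.tgtTo_succ hp.le]
  exact h

theorem tgt_composable (C : StrCat.{u} N) {n p : ℕ} (hp : p < n) {hn : InDim N (n + 1)}
    {y x : C.cell (n + 1) hn}
    (h : C.srcTo p (Nat.lt_succ_of_lt hp).le y = C.tgtTo p (Nat.lt_succ_of_lt hp).le x) :
    C.srcTo p hp.le (C.tgt y) = C.tgtTo p hp.le (C.tgt x) := by
  rw [← C.srcTo_src hp, ← C.srcTo_succ hp.le, ← C.tgtTo_succ hp.le]
  exact h

end StrCat

/-! ## The free strict `N`-category on an `N`-globular set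

The free strict `N`-category on `G` consists of the formal composites of cells of `G`, two of
them being identified if they have the same value under every morphism from `G` to a strict
`N`-category. That it is free is `freeAdj` below. -/

namespace FreeCat

open GlobSet

variable {N : ℕ∞} (G : GlobSet.{u} N)

/-- Formal composites of cells of `G`, disregarding composability. -/
inductive Raw : (n : ℕ) → InDim N n → Type u
  | gen {n : ℕ} {hn : InDim N n} (x : G.cell n hn) : Raw n hn
  | idc {n : ℕ} {hn : InDim N n} (hn' : InDim N (n + 1)) (a : Raw n hn) : Raw (n + 1) hn'
  | comp {n : ℕ} {hn : InDim N n} (p : ℕ) (hp : p < n) (b a : Raw n hn) : Raw n hn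

/-- The possible values of a formal composite, under all morphisms from `G` to a strict
`N`-category. -/
abbrev Val (n : ℕ) (hn : InDim N n) : Type (u + 1) :=
  ∀ (C : StrCat.{u} N), (G ⟶ C.toGlobSet) → C.cell n hn

/-- The formal composite is well formed, with the given values. -/
inductive Realizes : ∀ {n : ℕ} {hn : InDim N n}, Raw G n hn → Val G n hn → Prop
  | gen {n : ℕ} {hn : InDim N n} (x : G.cell n hn) :
      Realizes (Raw.gen x) (fun _ f => Hom.map f x)
  | idc {n : ℕ} {hn : InDim N n} (hn' : InDim N (n + 1)) {a : Raw G n hn} {φ : Val G n hn} :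
      Realizes a φ → Realizes (Raw.idc hn' a) (fun C f => C.idc hn' (φ C f))
  | comp {n : ℕ} {hn : InDim N n} (p : ℕ) (hp : p < n) {b a : Raw G n hn} {ψ φ : Val G n hn}
      (h : ∀ C f, C.srcTo p hp.le (ψ C f) = C.tgtTo p hp.le (φ C f)) :
      Realizes b ψ → Realizes a φ →
        Realizes (Raw.comp p hp b a) (fun C f => C.comp p hp (ψ C f) (φ C f) (h C f))

variable {G}

theorem Realizes.unique {n : ℕ} {hn : InDim N n} {a : Raw G n hn} {φ ψ : Val G n hn}
    (h : Realizes G a φ) (h' : Realizes G a ψ) : φ = ψ := by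
  induction h with
  | gen x => cases h'; rfl
  | idc hn' h ih =>
    cases h' with
    | idc _ h' => rw [ih h']
  | comp p hp h hb ha ihb iha =>
    cases h' with
    | comp _ _ h' hb' ha' =>
      obtain rfl := ihb hb'
      obtain rfl := iha ha'
      rfl

/-- The values of well formed composites. -/
def IsVal {n : ℕ} {hn : InDim N n} (φ : Val G n hn) : Prop := ∃ a, Realizes G a φ

instance (n : ℕ) (hn : InDim N n) : Small.{u} { φ : Val G n hn // IsVal φ } :=
  small_of_injective (f := fun φ : { φ : Val G n hn // IsVal φ } => φ.2.choose) (by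
    intro φ ψ h
    have h₁ := φ.2.choose_spec
    have h₂ := ψ.2.choose_spec
    have h' : φ.2.choose = ψ.2.choose := h
    rw [h'] at h₁
    exact Subtype.ext (h₁.unique h₂))

theorem isVal_idc {n : ℕ} {hn : InDim N n} (hn' : InDim N (n + 1)) {φ : Val G n hn}
    (h : IsVal φ) : IsVal (G := G) (fun C f => C.idc hn' (φ C f)) :=
  ⟨_, Realizes.idc hn' h.choose_spec⟩

theorem isVal_comp {n : ℕ} {hn : InDim N n} (p : ℕ) (hp : p < n) {ψ φ : Val G n hn}
    (h : ∀ C f, C.srcTo p hp.le (ψ C f) = C.tgtTo p hp.le (φ C f)) (hψ : IsVal ψ) (hφ : IsVal φ) :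
    IsVal (G := G) (fun C f => C.comp p hp (ψ C f) (φ C f) (h C f)) :=
  ⟨_, Realizes.comp p hp h hψ.choose_spec hφ.choose_spec⟩

theorem isVal_boundary {n : ℕ} {hn : InDim N (n + 1)} {φ : Val G (n + 1) hn} (h : IsVal φ) :
    IsVal (G := G) (fun C f => C.src (φ C f)) ∧ IsVal (G := G) (fun C f => C.tgt (φ C f)) := by
  let P : ∀ (m : ℕ) (hm : InDim N m), Val G m hm → Prop := fun m => match m with
    | 0 => fun _ _ => True
    | _ + 1 => fun _ φ =>
      IsVal (G := G) (fun C f => C.src (φ C f)) ∧ IsVal (G := G) (fun C f => C.tgt (φ C f))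
  suffices H : ∀ (m : ℕ) (hm : InDim N m) (a : Raw G m hm) (φ : Val G m hm),
      Realizes G a φ → P m hm φ from H _ _ _ _ h.choose_spec
  intro m hm a φ h
  induction h with
  | @gen m hm x =>
    cases m with
    | zero => trivial
    | succ m =>
      refine ⟨⟨Raw.gen (G.src x), ?_⟩, ⟨Raw.gen (G.tgt x), ?_⟩⟩
      · have := Realizes.gen (G.src x)
        simpa only [Hom.map_src] using this
      · have := Realizes.gen (G.tgt x)
        simpa only [Hom.map_tgt] using this
  | @idc m hm hm' a φ h ih =>
    refine ⟨⟨a, ?_⟩, ⟨a, ?_⟩⟩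
    · simpa only [StrCat.src_idc] using h
    · simpa only [StrCat.tgt_idc] using h
  | @comp m hm p hp b a ψ φ h hb ha ihb iha =>
    cases m with
    | zero => trivial
    | succ m =>
      rcases Nat.lt_succ_iff_lt_or_eq.mp hp with hp' | rfl
      · refine ⟨?_, ?_⟩
        · have := isVal_comp p hp' (fun C f => C.src_composable hp' (h C f)) ihb.1 iha.1
          simpa only [StrCat.src_comp _ hp' _ _ (h _ _) (StrCat.src_composable _ hp' (h _ _))]
            using this
        · have := isVal_comp p hp' (fun C f => C.tgt_composable hp' (h C f)) ihb.2 iha.2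
          simpa only [StrCat.tgt_comp _ hp' _ _ (h _ _) (StrCat.tgt_composable _ hp' (h _ _))]
            using this
      · refine ⟨?_, ?_⟩
        · simpa only [StrCat.src_comp_top] using iha.1
        · simpa only [StrCat.tgt_comp_top] using ihb.2

variable (G) in
/-- The `n`-cells of the free strict `N`-category on `G` (the `n`-pasting diagrams in `G`). -/
def Cell (n : ℕ) (hn : InDim N n) : Type u := Shrink.{u} { φ : Val G n hn // IsVal φ }

noncomputable def Cell.val {n : ℕ} {hn : InDim N n} (a : Cell G n hn) : Val G n hn :=
  ((equivShrink _).symm a).1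

theorem Cell.isVal {n : ℕ} {hn : InDim N n} (a : Cell G n hn) : IsVal a.val :=
  ((equivShrink _).symm a).2

noncomputable def Cell.mk {n : ℕ} {hn : InDim N n} (φ : Val G n hn) (h : IsVal φ) : Cell G n hn :=
  equivShrink _ ⟨φ, h⟩

@[simp] theorem Cell.val_mk {n : ℕ} {hn : InDim N n} (φ : Val G n hn) (h : IsVal φ) :
    (Cell.mk φ h).val = φ := by
  simp [Cell.mk, Cell.val]

theorem Cell.ext {n : ℕ} {hn : InDim N n} {a b : Cell G n hn}
    (h : ∀ C f, a.val C f = b.val C f) : a = b := by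
  apply (equivShrink _).symm.injective
  apply Subtype.ext
  funext C f
  exact h C f

variable (G) in
/-- The underlying globular set of the free strict `N`-category on `G`. -/
noncomputable def glob : GlobSet.{u} N where
  cell := Cell G
  src a := Cell.mk (fun C f => C.src (a.val C f)) (isVal_boundary a.isVal).1
  tgt a := Cell.mk (fun C f => C.tgt (a.val C f)) (isVal_boundary a.isVal).2
  src_src a := Cell.ext fun C f => by simp [C.src_src]
  tgt_src a := Cell.ext fun C f => by simp [C.tgt_src]

/-- Evaluation of formal composites. -/
noncomputable def ev (C : StrCat.{u} N) (f : G ⟶ C.toGlobSet) : glob G ⟶ C.toGlobSet where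
  map a := Cell.val a C f
  map_src a := by simp [glob]
  map_tgt a := by simp [glob]

theorem composable {n p : ℕ} {hn : InDim N n} (hp : p ≤ n) {b a : (glob G).cell n hn}
    (h : (glob G).srcTo p hp b = (glob G).tgtTo p hp a) (C : StrCat.{u} N) (f : G ⟶ C.toGlobSet) :
    C.srcTo p hp (Cell.val b C f) = C.tgtTo p hp (Cell.val a C f) := by
  have := congrArg (Hom.map (ev C f)) h
  rwa [Hom.map_srcTo, Hom.map_tgtTo] at this

theorem composable' {n p : ℕ} {hn : InDim N n} (hp : p ≤ n) {b a : (glob G).cell n hn}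
    (h : ∀ (C : StrCat.{u} N) (f : G ⟶ C.toGlobSet),
      C.srcTo p hp (Cell.val b C f) = C.tgtTo p hp (Cell.val a C f)) :
    (glob G).srcTo p hp b = (glob G).tgtTo p hp a := by
  refine Cell.ext fun C f => ?_
  change Hom.map (ev C f) _ = Hom.map (ev C f) _
  rw [Hom.map_srcTo, Hom.map_tgtTo]
  exact h C f

variable (G) in
/-- Identities and composition of formal composites. -/
noncomputable def pre : PreCat.{u} N where
  toGlobSet := glob G
  idc hn' a := Cell.mk (fun C f => C.idc hn' (Cell.val a C f)) (isVal_idc hn' (Cell.isVal a))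
  comp p hp b a h :=
    Cell.mk (fun C f => C.comp p hp (Cell.val b C f) (Cell.val a C f) (composable hp.le h C f))
      (isVal_comp p hp (composable hp.le h) (Cell.isVal b) (Cell.isVal a))

theorem val_src {n : ℕ} {hn : InDim N (n + 1)} (a : (pre G).cell (n + 1) hn) (C : StrCat.{u} N)
    (f : G ⟶ C.toGlobSet) : Cell.val ((pre G).src a) C f = C.src (Cell.val a C f) := by
  simp [pre, glob]

theorem val_tgt {n : ℕ} {hn : InDim N (n + 1)} (a : (pre G).cell (n + 1) hn) (C : StrCat.{u} N)
    (f : G ⟶ C.toGlobSet) : Cell.val ((pre G).tgt a) C f = C.tgt (Cell.val a C f) := by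
  simp [pre, glob]

theorem val_idc {n : ℕ} {hn : InDim N n} (hn' : InDim N (n + 1)) (a : (pre G).cell n hn)
    (C : StrCat.{u} N) (f : G ⟶ C.toGlobSet) :
    Cell.val ((pre G).idc hn' a) C f = C.idc hn' (Cell.val a C f) := by
  simp [pre]

theorem val_comp {n p : ℕ} {hn : InDim N n} (hp : p < n) (b a : (pre G).cell n hn) (h)
    (C : StrCat.{u} N) (f : G ⟶ C.toGlobSet) : Cell.val ((pre G).comp p hp b a h) C f =
      C.comp p hp (Cell.val b C f) (Cell.val a C f) (composable hp.le h C f) := by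
  simp [pre]

theorem val_srcTo {n p : ℕ} {hn : InDim N n} (hp : p ≤ n) (a : (pre G).cell n hn)
    (C : StrCat.{u} N) (f : G ⟶ C.toGlobSet) :
    Cell.val ((pre G).srcTo p hp a) C f = C.srcTo p hp (Cell.val a C f) :=
  Hom.map_srcTo (ev C f) p hp a

theorem val_tgtTo {n p : ℕ} {hn : InDim N n} (hp : p ≤ n) (a : (pre G).cell n hn)
    (C : StrCat.{u} N) (f : G ⟶ C.toGlobSet) :
    Cell.val ((pre G).tgtTo p hp a) C f = C.tgtTo p hp (Cell.val a C f) :=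
  Hom.map_tgtTo (ev C f) p hp a

theorem val_idTo {n p : ℕ} {hp : InDim N p} (hn : InDim N n) (h : p ≤ n) (a : (pre G).cell p hp)
    (C : StrCat.{u} N) (f : G ⟶ C.toGlobSet) :
    Cell.val ((pre G).idTo n hn h a) C f = C.idTo n hn h (Cell.val a C f) := by
  induction n, h using Nat.le_induction with
  | base => rw [PreCat.idTo_self, PreCat.idTo_self]
  | succ n h ih =>
    rw [PreCat.idTo_succ _ hn h, PreCat.idTo_succ _ hn h, val_idc, ih]

variable (G) in
/-- The free strict `N`-category on `G`. -/
noncomputable def free : StrCat.{u} N where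
  toPreCat := pre G
  src_idc x := Cell.ext fun C f => by rw [val_src, val_idc, C.src_idc]
  tgt_idc x := Cell.ext fun C f => by rw [val_tgt, val_idc, C.tgt_idc]
  src_comp_top y x h := Cell.ext fun C f => by rw [val_src, val_comp, C.src_comp_top, val_src]
  tgt_comp_top y x h := Cell.ext fun C f => by rw [val_tgt, val_comp, C.tgt_comp_top, val_tgt]
  src_comp hp _ y x h h' := Cell.ext fun C f => by
    rw [val_src, val_comp, val_comp, C.src_comp hp _ _ _ (C.src_composable hp (composable _ h C f))]
    simp only [val_src]
  tgt_comp hp _ y x h h' := Cell.ext fun C f => by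
    rw [val_tgt, val_comp, val_comp, C.tgt_comp hp _ _ _ (C.tgt_composable hp (composable _ h C f))]
    simp only [val_tgt]
  comp_assoc hp _ z y x h₁ h₂ h₃ h₄ := Cell.ext fun C f => by
    have e₂ := composable hp.le h₂ C f
    have e₄ := composable hp.le h₄ C f
    rw [val_comp] at e₂ e₄
    simp only [val_comp]
    exact C.comp_assoc hp _ _ _ (composable hp.le h₁ C f) e₂ (composable hp.le h₃ C f) e₄
  id_comp hp _ x h := Cell.ext fun C f => by
    have e := composable hp.le h C f
    rw [val_idTo, val_tgtTo] at e
    simp only [val_comp, val_idTo, val_tgtTo]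
    exact C.id_comp hp _ e
  comp_id hp _ x h := Cell.ext fun C f => by
    have e := composable hp.le h C f
    rw [val_idTo, val_srcTo] at e
    simp only [val_comp, val_idTo, val_srcTo]
    exact C.comp_id hp _ e
  interchange hq hp _ y' y x' x h₁ h₂ h₃ h₄ h₅ h₆ := Cell.ext fun C f => by
    have e₃ := composable (hq.trans hp).le h₃ C f
    have e₆ := composable hp.le h₆ C f
    rw [val_comp, val_comp] at e₃ e₆
    simp only [val_comp]
    exact C.interchange hq hp _ _ _ _ (composable hp.le h₁ C f) (composable hp.le h₂ C f) e₃
      (composable (hq.trans hp).le h₄ C f) (composable (hq.trans hp).le h₅ C f) e₆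
  idc_comp hq hn y x h h' := Cell.ext fun C f => by
    have e := composable (Nat.lt_succ_of_lt hq).le h' C f
    rw [val_idc, val_idc] at e
    simp only [val_comp, val_idc]
    exact C.idc_comp hq _ _ (composable hq.le h C f) e

theorem isVal_gen {n : ℕ} {hn : InDim N n} (x : G.cell n hn) :
    IsVal (G := G) (hn := hn) (fun _ f => Hom.map f x) := ⟨_, Realizes.gen x⟩

variable (G) in
/-- The inclusion of the cells of `G` as generators. -/
noncomputable def incl : G ⟶ (free G).toGlobSet where
  map x := Cell.mk (fun _ f => Hom.map f x) (isVal_gen x)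
  map_src x := Cell.ext fun C f => by
    refine Eq.trans ?_ (val_src _ C f).symm
    rw [Cell.val_mk, Cell.val_mk, Hom.map_src]
  map_tgt x := Cell.ext fun C f => by
    refine Eq.trans ?_ (val_tgt _ C f).symm
    rw [Cell.val_mk, Cell.val_mk, Hom.map_tgt]

/-- The strict functor extending a morphism from `G` to a strict `N`-category. -/
noncomputable def lift {C : StrCat.{u} N} (f : G ⟶ C.toGlobSet) : free G ⟶ C where
  hom := ev C f
  map_idc {_ hn} x := val_idc hn x C f
  map_comp hp _ y x h _ := val_comp hp y x h C f

theorem incl_lift {C : StrCat.{u} N} (f : G ⟶ C.toGlobSet) :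
    incl G ≫ StrCat.Hom.hom (lift f) = f :=
  hom_ext _ _ fun k hk x => by
    change Cell.val (Cell.mk _ (isVal_gen x)) C f = _
    rw [Cell.val_mk]

theorem lift_unique {C : StrCat.{u} N} (g : free G ⟶ C) :
    lift (incl G ≫ StrCat.Hom.hom g) = g := by
  have key : ∀ (n : ℕ) (hn : InDim N n) (t : Raw G n hn) (φ : Val G n hn), Realizes G t φ →
      ∀ h : IsVal φ, Hom.map (StrCat.Hom.hom g) (Cell.mk φ h : (free G).cell n hn) =
        φ C (incl G ≫ StrCat.Hom.hom g) := by
    intro n hn t φ ht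
    induction ht with
    | gen x => intro _; rfl
    | @idc m hm hm' a φ ha ih =>
      intro h
      have hφ : IsVal φ := ⟨a, ha⟩
      have e : (Cell.mk _ h : (free G).cell (m + 1) hm') =
          (free G).idc hm' (Cell.mk φ hφ : (free G).cell m hm) :=
        Cell.ext fun D f => by
          refine Eq.trans ?_ (val_idc hm' _ D f).symm
          rw [Cell.val_mk, Cell.val_mk]
      rw [e]
      exact (StrCat.Hom.map_idc g _).trans (by rw [ih])
    | @comp m hm p hp b a ψ φ h hb ha ihb iha =>
      intro h'
      have hψ : IsVal ψ := ⟨b, hb⟩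
      have hφ : IsVal φ := ⟨a, ha⟩
      have hc : (free G).srcTo p hp.le (Cell.mk ψ hψ : (free G).cell m hm) =
          (free G).tgtTo p hp.le (Cell.mk φ hφ : (free G).cell m hm) :=
        composable' hp.le fun D f => by rw [Cell.val_mk, Cell.val_mk]; exact h D f
      have e : (Cell.mk _ h' : (free G).cell m hm) = (free G).comp p hp _ _ hc :=
        Cell.ext fun D f => by
          refine Eq.trans ?_ (val_comp hp _ _ hc D f).symm
          simp only [Cell.val_mk]
      have hc' := congrArg (Hom.map (StrCat.Hom.hom g)) hc
      have hc'' := ((Hom.map_srcTo (StrCat.Hom.hom g) _ _ _).symm.trans hc').trans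
        (Hom.map_tgtTo (StrCat.Hom.hom g) _ _ _)
      rw [e]
      refine (StrCat.Hom.map_comp g hp _ _ hc hc'').trans ?_
      simp only [ihb, iha]
  apply StrCat.Hom.ext
  refine hom_ext _ _ fun n hn a => ?_
  have ha : a = Cell.mk (Cell.val a) (Cell.isVal a) := Cell.ext fun C f => by rw [Cell.val_mk]
  obtain ⟨t, ht⟩ := Cell.isVal a
  conv_rhs => rw [ha]
  exact (key n hn t _ ht _).symm

/-- The universal property of the free strict `N`-category. -/
noncomputable def homEquiv (G : GlobSet.{u} N) (C : StrCat.{u} N) :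
    (free G ⟶ C) ≃ (G ⟶ (StrCat.forget N).obj C) where
  toFun g := incl G ≫ (StrCat.forget N).map g
  invFun f := lift f
  left_inv g := lift_unique g
  right_inv f := incl_lift f

theorem src_eq_tgt_of_one {k : ℕ} {hk : InDim N (k + 1)}
    (x : (glob (GlobSet.one.{u} N)).cell (k + 1) hk) : (glob _).src x = (glob _).tgt x := by
  let P : ∀ (m : ℕ) (hm : InDim N m), Val (GlobSet.one.{u} N) m hm → Prop := fun m => match m with
    | 0 => fun _ _ => True
    | _ + 1 => fun _ φ => ∀ (C : StrCat.{u} N) (f : GlobSet.one.{u} N ⟶ C.toGlobSet),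
      C.src (φ C f) = C.tgt (φ C f)
  suffices H : ∀ (m : ℕ) (hm : InDim N m) (a : Raw (GlobSet.one.{u} N) m hm) (φ),
      Realizes _ a φ → P m hm φ by
    obtain ⟨t, ht⟩ := Cell.isVal x
    exact Cell.ext fun C f => (val_src x C f).trans ((H _ _ _ _ ht C f).trans (val_tgt x C f).symm)
  intro m hm a φ h
  induction h with
  | @gen m hm x =>
    cases m with
    | zero => trivial
    | succ m => intro C f; rw [← Hom.map_src, ← Hom.map_tgt]; rfl
  | @idc m hm hm' a φ h ih => intro C f; rw [C.src_idc, C.tgt_idc]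
  | @comp m hm p hp b a ψ φ h hb ha ihb iha =>
    cases m with
    | zero => trivial
    | succ m =>
      intro C f
      rcases Nat.lt_succ_iff_lt_or_eq.mp hp with hp' | rfl
      · rw [C.src_comp hp' _ _ (h C f) (C.src_composable hp' (h C f)),
          C.tgt_comp hp' _ _ (h C f) (C.tgt_composable hp' (h C f))]
        simp only [ihb C f, iha C f]
      · rw [C.src_comp_top, C.tgt_comp_top, iha C f, ← ihb C f]
        have := h C f
        rw [C.srcTo_succ le_rfl, C.tgtTo_succ le_rfl, C.srcTo_self, C.tgtTo_self] at this
        exact this.symm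

end FreeCat

/-- The free strict `N`-category functor `GSet_N ⥤ Str N-Cat`. -/
noncomputable def freeCat (N : ℕ∞) : GlobSet.{u} N ⥤ StrCat.{u} N :=
  Adjunction.leftAdjointOfEquiv (G := StrCat.forget N) FreeCat.homEquiv fun _ _ _ _ _ => rfl

/-- The free strict `N`-category functor is left adjoint to the forgetful functor. -/
noncomputable def freeAdj (N : ℕ∞) : freeCat.{u} N ⊣ StrCat.forget.{u} N :=
  Adjunction.adjunctionOfEquivLeft _ _

/-- The free strict `N`-category monad `(-)^*` on `GSet_N`. -/
noncomputable def freeMonad (N : ℕ∞) : Monad (GlobSet.{u} N) := (freeAdj N).toMonad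

/-! ## Globular collections and globular operads -/

/-- The globular set `1^*` of shapes of pasting diagrams. -/
noncomputable abbrev oneStar (N : ℕ∞) : GlobSet.{u} N := (freeMonad N).obj (GlobSet.one N)

/-- The boundary `∂τ` of a cell of `1^*`: its source, which is also its target. -/
noncomputable def bdry {N : ℕ∞} {k : ℕ} {hk : InDim N (k + 1)}
    (τ : (oneStar.{u} N).cell (k + 1) hk) : (oneStar.{u} N).cell k hk.pred :=
  (oneStar N).src τ

theorem bdry_eq_tgt {N : ℕ∞} {k : ℕ} {hk : InDim N (k + 1)}
    (τ : (oneStar.{u} N).cell (k + 1) hk) : bdry τ = (oneStar N).tgt τ :=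
  FreeCat.src_eq_tgt_of_one τ

/-- The category `GColl_N = GSet_N / 1^*` of `N`-globular collections. -/
abbrev GColl (N : ℕ∞) := Over (oneStar.{u} N)

namespace GColl

open GlobSet

variable {N : ℕ∞}

/-- The underlying globular set of `X ∘ Y`, where `X` is `g : G ⟶ 1^*` and `Y` is `h : H ⟶ 1^*`:
the pullback of `!^* : G^* ⟶ 1^*` and `h`. -/
noncomputable def tensorGlob (X Y : GColl.{u} N) : GlobSet.{u} N :=
  pull ((freeMonad N).map (toOne X.left)) Y.hom

noncomputable def tensorFst (X Y : GColl.{u} N) : tensorGlob X Y ⟶ (freeMonad N).obj X.left :=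
  pullFst _ _

noncomputable def tensorSnd (X Y : GColl.{u} N) : tensorGlob X Y ⟶ Y.left :=
  pullSnd _ _

theorem tensor_condition (X Y : GColl.{u} N) :
    tensorFst X Y ≫ (freeMonad N).map (toOne X.left) = tensorSnd X Y ≫ Y.hom :=
  pull_condition _ _

/-- The collection `X ∘ Y`. -/
noncomputable def tensor (X Y : GColl.{u} N) : GColl.{u} N :=
  Over.mk (tensorFst X Y ≫ (freeMonad N).map X.hom ≫ (freeMonad N).μ.app (one N))

/-- The collection `η_1 : 1 ⟶ 1^*`. -/
noncomputable def unit (N : ℕ∞) : GColl.{u} N := Over.mk ((freeMonad N).η.app (one N))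

section aux
variable {𝒞 : Type*} [Category 𝒞] (T : Monad 𝒞)

theorem aux_map {P G G' H H' O : 𝒞} {fst : P ⟶ T.obj G} {snd : P ⟶ H} {g : G ⟶ O}
    {g' : G' ⟶ O} {h : H ⟶ T.obj O} {h' : H' ⟶ T.obj O} {a : G ⟶ G'} {b : H ⟶ H'}
    (ha : a ≫ g' = g) (hb : b ≫ h' = h) (w : fst ≫ T.map g = snd ≫ h) :
    (fst ≫ T.map a) ≫ T.map g' = (snd ≫ b) ≫ h' := by
  rw [Category.assoc, Category.assoc, hb, ← T.map_comp, ha, w]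

theorem aux_map_w {P G G' O : 𝒞} {fst : P ⟶ T.obj G} {g : G ⟶ T.obj O} {g' : G' ⟶ T.obj O}
    {a : G ⟶ G'} (ha : a ≫ g' = g) :
    (fst ≫ T.map a) ≫ T.map g' ≫ T.μ.app O = fst ≫ T.map g ≫ T.μ.app O := by
  rw [Category.assoc, ← T.map_comp_assoc, ha]

theorem aux_left {G O : 𝒞} (g : G ⟶ T.obj O) {i : O ⟶ O} (hi : i = 𝟙 O) :
    g ≫ T.map i = 𝟙 G ≫ g := by
  rw [hi, T.map_id, Category.comp_id, Category.id_comp]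

theorem aux_left_w {G O : 𝒞} (g : G ⟶ T.obj O) :
    g ≫ T.map (T.η.app O) ≫ T.μ.app O = g := by
  have := T.right_unit O
  rw [this]
  exact Category.comp_id g

theorem aux_right_w {G O : 𝒞} (g : G ⟶ T.obj O) :
    T.η.app G ≫ T.map g ≫ T.μ.app O = g := by
  have := T.η.naturality g
  rw [← Category.assoc]
  refine (congrArg (· ≫ T.μ.app O) this.symm).trans ?_
  simp

theorem aux_assoc_inner {P Q Y Z O : 𝒞} {fst : P ⟶ T.obj Q} {snd : P ⟶ Z} {q : Q ⟶ Y}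
    {y : Y ⟶ O} {yQ : Q ⟶ O} {z : Z ⟶ T.obj O} (hq : q ≫ y = yQ)
    (w : fst ≫ T.map yQ = snd ≫ z) : (fst ≫ T.map q) ≫ T.map y = snd ≫ z := by
  rw [Category.assoc, ← T.map_comp, hq, w]

theorem aux_assoc {P Q X Y O : 𝒞} {fst : P ⟶ T.obj Q} {p : Q ⟶ T.obj X} {q : Q ⟶ Y}
    {x : X ⟶ O} {y : Y ⟶ T.obj O} (w : p ≫ T.map x = q ≫ y) :
    (fst ≫ T.map p ≫ T.μ.app X) ≫ T.map x = (fst ≫ T.map q) ≫ T.map y ≫ T.μ.app O := by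
  have h := T.μ.naturality x
  have h' : T.μ.app X ≫ T.map x = T.map (T.map x) ≫ T.μ.app O := h.symm
  rw [Category.assoc, Category.assoc, Category.assoc, h', ← T.map_comp_assoc, w,
    T.map_comp_assoc]

theorem aux_assoc_w {P Q X O : 𝒞} {fst : P ⟶ T.obj Q} {p : Q ⟶ T.obj X} {x : X ⟶ T.obj O} :
    (fst ≫ T.map p ≫ T.μ.app X) ≫ T.map x ≫ T.μ.app O =
      fst ≫ T.map (p ≫ T.map x ≫ T.μ.app O) ≫ T.μ.app O := by
  have h : T.μ.app X ≫ T.map x = T.map (T.map x) ≫ T.μ.app (T.obj O) := (T.μ.naturality x).symm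
  have h' : T.map (T.μ.app O) ≫ T.μ.app O = T.μ.app (T.obj O) ≫ T.μ.app O := T.assoc O
  simp only [Category.assoc, T.map_comp]
  rw [h', reassoc_of% h]

end aux

/-- The action of `∘` on a pair of morphisms of collections. -/
noncomputable def tensorMap {X X' Y Y' : GColl.{u} N} (a : X ⟶ X') (b : Y ⟶ Y') :
    tensor X Y ⟶ tensor X' Y' :=
  Over.homMk (U := tensor X Y) (V := tensor X' Y')
    (pullLift (tensorFst X Y ≫ (freeMonad N).map a.left) (tensorSnd X Y ≫ b.left)
      (aux_map (freeMonad N) (toOne_unique _ _) (Over.w b) (tensor_condition X Y)))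
    (aux_map_w (freeMonad N) (Over.w a))

/-- The inverse of the left unit isomorphism `1 ∘ X ≅ X`. -/
noncomputable def leftUnitorInv (X : GColl.{u} N) : X ⟶ tensor (unit N) X :=
  Over.homMk (U := X) (V := tensor (unit N) X)
    (pullLift X.hom (𝟙 X.left) (aux_left (freeMonad N) X.hom (toOne_unique _ _)))
    (aux_left_w (freeMonad N) X.hom)

/-- The inverse of the right unit isomorphism `X ∘ 1 ≅ X`. -/
noncomputable def rightUnitorInv (X : GColl.{u} N) : X ⟶ tensor X (unit N) :=
  Over.homMk (U := X) (V := tensor X (unit N))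
    (pullLift ((freeMonad N).η.app X.left) (toOne X.left)
      ((freeMonad N).η.naturality (toOne X.left)).symm)
    (aux_right_w (freeMonad N) X.hom)

/-- The associativity isomorphism `(X ∘ Y) ∘ Z ⟶ X ∘ (Y ∘ Z)`. On cells it sends `(ρ, z)`, where
`ρ` is a pasting diagram of cells `(πᵢ, yᵢ)` of `X ∘ Y`, to `(π, (y, z))`, where `π` is the pasting
diagram composed of the `πᵢ`, and `y` is that of the `yᵢ`. -/
noncomputable def assoc (X Y Z : GColl.{u} N) :
    tensor (tensor X Y) Z ⟶ tensor X (tensor Y Z) :=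
  Over.homMk (U := tensor (tensor X Y) Z) (V := tensor X (tensor Y Z))
    (pullLift
      (tensorFst (tensor X Y) Z ≫ (freeMonad N).map (tensorFst X Y) ≫ (freeMonad N).μ.app X.left)
      (pullLift (tensorFst (tensor X Y) Z ≫ (freeMonad N).map (tensorSnd X Y))
        (tensorSnd (tensor X Y) Z)
        (aux_assoc_inner (freeMonad N) (toOne_unique _ _) (tensor_condition (tensor X Y) Z)))
      (aux_assoc (freeMonad N) (tensor_condition X Y)))
    (aux_assoc_w (freeMonad N))

end GColl

/-- An `N`-globular operad: a monoid in `(GColl_N, ∘)`. For `N = ⊤` this is a globular operad. -/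
structure GlobOperad (N : ℕ∞) where
  /-- The underlying collection `g : G ⟶ 1^*`. -/
  coll : GColl.{u} N
  ids : GColl.unit N ⟶ coll
  comp : GColl.tensor coll coll ⟶ coll
  ids_comp : GColl.leftUnitorInv coll ≫ GColl.tensorMap ids (𝟙 coll) ≫ comp = 𝟙 coll
  comp_ids : GColl.rightUnitorInv coll ≫ GColl.tensorMap (𝟙 coll) ids ≫ comp = 𝟙 coll
  comp_assoc : GColl.tensorMap comp (𝟙 coll) ≫ comp =
    GColl.assoc coll coll coll ≫ GColl.tensorMap (𝟙 coll) comp ≫ comp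

/-- The underlying `N`-globular set `G` of an `N`-globular operad. -/
noncomputable abbrev GlobOperad.glob {N : ℕ∞} (G : GlobOperad.{u} N) : GlobSet.{u} N := G.coll.left

/-- The underlying collection map `g : G ⟶ 1^*` of an `N`-globular operad. -/
noncomputable abbrev GlobOperad.map {N : ℕ∞} (G : GlobOperad.{u} N) : G.glob ⟶ oneStar.{u} N :=
  G.coll.hom

/-! ## Contractibility -/

/-- A contraction function on a collection `g : G ⟶ 1^*`: a choice, for each parallel pair
`(x, x')` of `k`-cells of `G` and each `(k+1)`-cell `τ` of `1^*` with `g(x) = g(x') = ∂τ`, of a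
`(k+1)`-cell `χ : x ⟶ x'` of `G` with `g(χ) = τ`. -/
structure ContractionFunction {N : ℕ∞} {G : GlobSet.{u} N} (g : G ⟶ oneStar.{u} N) where
  fill : ∀ {k : ℕ} {hk : InDim N (k + 1)} (x x' : G.cell k hk.pred)
    (τ : (oneStar.{u} N).cell (k + 1) hk), G.Parallel x x' →
    GlobSet.Hom.map g x = bdry τ → GlobSet.Hom.map g x' = bdry τ → G.cell (k + 1) hk
  src_fill : ∀ {k : ℕ} {hk : InDim N (k + 1)} (x x' : G.cell k hk.pred)
    (τ : (oneStar.{u} N).cell (k + 1) hk) (hx) (h) (h'), G.src (fill x x' τ hx h h') = x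
  tgt_fill : ∀ {k : ℕ} {hk : InDim N (k + 1)} (x x' : G.cell k hk.pred)
    (τ : (oneStar.{u} N).cell (k + 1) hk) (hx) (h) (h'), G.tgt (fill x x' τ hx h h') = x'
  map_fill : ∀ {k : ℕ} {hk : InDim N (k + 1)} (x x' : G.cell k hk.pred)
    (τ : (oneStar.{u} N).cell (k + 1) hk) (hx) (h) (h'),
    GlobSet.Hom.map g (fill x x' τ hx h h') = τ

/-- A globular operad is contractible if it has a contraction function. -/
def GlobOperad.IsContractible (G : GlobOperad.{u} ⊤) : Prop :=
  Nonempty (ContractionFunction G.map)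

/-- An `n`-globular operad is contractible if it has a contraction function and any two parallel
`n`-cells with the same image in `1^*` are equal. -/
def GlobOperad.IsNContractible {n : ℕ} (G : GlobOperad.{u} (n : ℕ∞)) : Prop :=
  Nonempty (ContractionFunction G.map) ∧
    ∀ χ χ' : G.glob.cell n (InDim.self n), G.glob.Parallel χ χ' →
      GlobSet.Hom.map G.map χ = GlobSet.Hom.map G.map χ' → χ = χ'

/-! A contraction function is a simultaneous choice of preimages for the restrictions of `g` to
hom-sets, so its existence is surjectivity of those restrictions together with the axiom of choice.
The point to check is that the two notions concern the same cells `τ`. Surjectivity of the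
restriction of `g` to the cells from `x` to `x'` concerns those `τ` with `s(τ) = g(x)` and `t(τ) =
g(x')`, whereas a contraction function concerns those with `g(x) = g(x') = ∂τ`. In `1^*` the source
and the target of a cell of positive dimension coincide (`bdry_eq_tgt`), so the two conditions
agree. When `g(x)` and `g(x')` differ, no such `τ` exists and both requirements are vacuous. Both
notions also start in the same place: fillers live in dimension `k + 1`, and fullness is imposed
only in positive dimensions. This is `ContractionFunction.nonempty_iff`, valid for every `N`.

For the second clause in finite dimension `n`, two cells are parallel exactly when they lie in a
common hom-set, and the endpoints of that hom-set are themselves parallel by the globular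
identities. Hence injectivity on all hom-sets between parallel cells is the statement that parallel
cells with equal images are equal. In dimension `0`, where any two cells are parallel, this is the
injectivity demanded by convention. This is `kFaithful_iff`. -/

namespace GlobSet

variable {N : ℕ∞}

/-- The source and the target of a cell are parallel. -/
theorem parallel_src_tgt (G : GlobSet.{u} N) {k : ℕ} {hk : InDim N (k + 1)}
    (z : G.cell (k + 1) hk) : G.Parallel (G.src z) (G.tgt z) := by
  -- Parallelism is defined by cases on the dimension: it is no condition on `0`-cells, and above
  -- that it amounts here to `ss = st` and `ts = tt`.
  cases k with
  | zero => trivial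
  | succ k => exact ⟨G.src_src z, G.tgt_src z⟩

/-- A morphism is `k`-faithful if and only if parallel `k`-cells with the same image are equal. -/
theorem kFaithful_iff {G H : GlobSet.{u} N} (f : G ⟶ H) {k : ℕ} (hk : InDim N k) :
    KFaithful f k hk ↔
      ∀ z z' : G.cell k hk, G.Parallel z z' → Hom.map f z = Hom.map f z' → z = z' := by
  cases k with
  -- All `0`-cells are parallel, so the criterion reduces to injectivity on `0`-cells.
  | zero => exact ⟨fun h z z' _ e => h e, fun h z z' e => h z z' trivial e⟩
  | succ k =>
    constructor
    · intro h z z' hz e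
      -- Both cells are placed in the hom-set with the endpoints of `z'`: for `z'` this is
      -- reflexivity, and for `z` it is exactly the parallelism `hz`.
      exact congrArg Subtype.val (h _ _ (G.parallel_src_tgt z') (a₁ := ⟨z, hz⟩)
        (a₂ := ⟨z', rfl, rfl⟩) (Subtype.ext e))
    -- The endpoints are replaced by those of `z`; membership of `z'` in the same hom-set then says
    -- that `z'` and `z` are parallel.
    · rintro h x x' - ⟨z, rfl, rfl⟩ ⟨z', hs, ht⟩ e
      exact Subtype.ext (h z z' ⟨hs.symm, ht.symm⟩ (congrArg Subtype.val e))

end GlobSet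

/-- A collection has a contraction function if and only if its structure map is full. -/
theorem ContractionFunction.nonempty_iff {N : ℕ∞} {G : GlobSet.{u} N} (g : G ⟶ oneStar.{u} N) :
    Nonempty (ContractionFunction g) ↔ GlobSet.IsFull g := by
  constructor
  · rintro ⟨c⟩ (_ | k) hk h0
    -- Fullness asks nothing in dimension `0`, and a contraction function supplies nothing there.
    · exact absurd h0 (lt_irrefl 0)
    · rintro x x' hx ⟨τ, hs, ht⟩
      -- Since `∂τ` is defined as the source of `τ`, the condition on `x` is immediate; the one on
      -- `x'` needs the equality of source and target in `1^*`.
      have h : GlobSet.Hom.map g x = bdry τ := hs.symm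
      have h' : GlobSet.Hom.map g x' = bdry τ := ht.symm.trans (bdry_eq_tgt τ).symm
      exact ⟨⟨c.fill x x' τ hx h h', c.src_fill x x' τ hx h h', c.tgt_fill x x' τ hx h h'⟩,
        Subtype.ext (c.map_fill x x' τ hx h h')⟩
  · intro hg
    -- The filler and its three properties are gathered in a single existential, so that one choice
    -- provides a cell satisfying all of them.
    have key : ∀ {k : ℕ} {hk : InDim N (k + 1)} (x x' : G.cell k hk.pred)
        (τ : (oneStar.{u} N).cell (k + 1) hk), G.Parallel x x' →
        GlobSet.Hom.map g x = bdry τ → GlobSet.Hom.map g x' = bdry τ →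
        ∃ χ : G.cell (k + 1) hk, G.src χ = x ∧ G.tgt χ = x' ∧ GlobSet.Hom.map g χ = τ := by
      intro k hk x x' τ hx h h'
      -- The boundary conditions make `τ` a cell from `g(x)` to `g(x')`, again because its target is
      -- also `∂τ`; a preimage under the restriction is the required filler.
      obtain ⟨⟨χ, hs, ht⟩, hχ⟩ := hg (k + 1) hk k.succ_pos x x' hx
        ⟨τ, h.symm, (bdry_eq_tgt τ).symm.trans h'.symm⟩
      exact ⟨χ, hs, ht, congrArg Subtype.val hχ⟩
    exact ⟨{
      fill := fun x x' τ hx h h' => (key x x' τ hx h h').choose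
      src_fill := fun x x' τ hx h h' => (key x x' τ hx h h').choose_spec.1
      tgt_fill := fun x x' τ hx h h' => (key x x' τ hx h h').choose_spec.2.1
      map_fill := fun x x' τ hx h h' => (key x x' τ hx h h').choose_spec.2.2 }⟩

theorem mainTheorem10 :
    (∀ G : GlobOperad.{u} ⊤, G.IsContractible ↔ GlobSet.IsFull G.map) ∧
    (∀ (n : ℕ) (G : GlobOperad.{u} (n : ℕ∞)),
      G.IsNContractible ↔
        GlobSet.IsFull G.map ∧ GlobSet.KFaithful G.map n (InDim.self n)) :=
  -- For finite `n` the two conjuncts match separately: the contraction function with fullness, and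
  -- the uniqueness of top-dimensional cells with `n`-faithfulness.
  ⟨fun G => ContractionFunction.nonempty_iff G.map, fun _ G =>
    and_congr (ContractionFunction.nonempty_iff G.map) (GlobSet.kFaithful_iff G.map _).symm⟩
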